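/- Theorem (factorization). For $n\in\mathbb{Z}$ let $\Pi_n(\mathbb{S}^2)$ denote the space of restrictions to the unit sphere $\mathbb{S}^2\subset\mathbb{R}^3$ of real polynomials in three variables $(x,y,z)$ of degree at most $n$, with $\Pi_n(\mathbb{S}^2)=\{0\}$ for $n<0$. For $T\in\Pi_n(\mathbb{S}^2)$ put $\widetilde T(\theta,\phi)=T(\sin\theta\cos\phi,\sin\theta\sin\phi,\cos\theta)$, and for $\alpha\in\{0,1\}$ and a positive integer $m$ put $$\Theta_{\alpha,m}=\Big\{\tfrac{(2j+\alpha)\pi}{2m} : j=0,1,\dots,2m-1\Big\}.$$ Let $m$ and $s$ be positive integers with $m\le s\le 2m-1$, and let $\lambda=s-m+1$. Let $\theta_1,\dots,\theta_{2\lambda}$ be distinct numbers in $(0,\pi)$ with $\theta_{2\lambda+1-i}=\pi-\theta_i$ for $i=1,\dots,\lambda$, and suppose that $\theta_1,\dots,\theta_\lambda$ lie on the same side of the equator, i.e. either all of them are less than $\pi/2$ or all of them are greater than $\pi/2$. If $T_s\in\Pi_s(\mathbb{S}^2)$ satisfies $$\widetilde T_s(\theta_i,\phi)=0\quad\text{for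 }\phi\in\Theta_{0,m},\ 1\le i\le\lambda,\qquad\text{and}\qquad \widetilde T_s(\theta_i,\phi)=0\quad\text{for }\phi\in\Theta_{1,m},\ \lambda+1\le i\le 2\lambda,$$ then there is $T^*\in\Pi_{s-2\lambda}(\mathbb{S}^2)$ such that, for all $(x,y,z)\in\mathbb{S}^2$, $$T_s(x,y,z)=\prod_{i=1}^{2\lambda}(z-\cos\theta_i)\;T^*(x,y,z),$$ and $T^*\equiv 0$ if $s=2m-1$. -/

import Mathlib

noncomputable section

/-- The unit sphere of Euclidean three-space. -/
abbrev UnitSphere : Type :=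
  Metric.sphere (0 : EuclideanSpace ℝ (Fin 3)) 1

/-- The restriction to the unit sphere of a real polynomial in three variables. -/
def restrictToSphere : MvPolynomial (Fin 3) ℝ →ₗ[ℝ] (UnitSphere → ℝ) :=
  LinearMap.pi fun p => (MvPolynomial.aeval (fun i => (p : EuclideanSpace ℝ (Fin 3)) i)).toLinearMap

/-- The space of spherical polynomials of degree at most `n`: the restrictions to the unit sphere of
the real polynomials in three variables all of whose monomials have total degree at most `n`.
For negative `n` only the zero polynomial satisfies this, so the space is zero. -/
def sphericalPolynomials (n : ℤ) : Submodule ℝ (UnitSphere → ℝ) :=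
  (MvPolynomial.restrictSupport ℝ {d : Fin 3 →₀ ℕ | (d.degree : ℤ) ≤ n}).map restrictToSphere

/-- The point of the unit sphere with spherical coordinates `(θ, φ)`. -/
def spherePoint (θ φ : ℝ) : UnitSphere :=
  ⟨!₂[Real.sin θ * Real.cos φ, Real.sin θ * Real.sin φ, Real.cos θ], by
    rw [mem_sphere_zero_iff_norm, EuclideanSpace.norm_eq, Real.sqrt_eq_one]
    simp only [Real.norm_eq_abs, sq_abs, Fin.sum_univ_three, Matrix.cons_val]
    nlinarith [Real.sin_sq_add_cos_sq θ, Real.sin_sq_add_cos_sq φ]⟩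

/-- The height `z` of a point of the sphere, its third coordinate. -/
def sphereHeight (p : UnitSphere) : ℝ := (p : EuclideanSpace ℝ (Fin 3)) 2

/-- The set of the `2 m` equidistant angles `(2 j + α) π / (2 m)`, `j = 0, …, 2 m - 1`. -/
def equidistantAngles (α : ℝ) (m : ℕ) : Set ℝ :=
  {φ | ∃ j : ℕ, j < 2 * m ∧ φ = (2 * (j : ℝ) + α) * Real.pi / (2 * (m : ℝ))}

end

/-! With w = x + iy, expand T = ∑ a_k(z) Re w^k + b_k(z) Im w^k, where a_k and b_k have degree at
most s - k. It suffices that all of them vanish at every t_i = cos θ_i. On one latitude, 2m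
equidistant zeros couple only the frequencies k and 2m - k: a_k ± (1 - t²)^(m-k) a_{2m-k} = 0 at
t_i, the sign depending on the family of angles, and similarly for b with the sign reversed. If k <
2m - s, the partner is absent and the claim is immediate. If k = m, then a_m vanishes on one half of
the nodes and b_m on the other, too many for degree s - m = λ - 1. Every remaining pair vanishes
identically, by `eq_zero_of_alternating_zeros`.

For that, t = (y - 1)/(y + 1) turns t ↦ -t into y ↦ 1/y. Sums and differences of the relations at ±t
are polynomials in y with zeros in (1, ∞) and with outer coefficients that are palindromic up to
sign. Euler operators delete the middle coefficients, each costing one zero by Rolle. The zeros that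
survive pair with their inverses, and the Descartes bound is exceeded
(`eq_zero_of_extreme_coeff_symm`). -/

noncomputable section

open Polynomial

/-! ### Counting positive zeros by Rolle and Descartes -/

/-- The differential operator `X d/dX - j` on polynomials. -/
def eulerOp (j : ℕ) (g : ℝ[X]) : ℝ[X] := X * derivative g - C (j : ℝ) * g

theorem coeff_eulerOp (j : ℕ) (g : ℝ[X]) (i : ℕ) :
    (eulerOp j g).coeff i = ((i : ℝ) - j) * g.coeff i := by
  cases i with
  | zero => simp [eulerOp]
  | succ n =>
    simp only [eulerOp, coeff_sub, coeff_X_mul, coeff_derivative, coeff_C_mul]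
    push_cast
    ring

/-- Between two positive zeros of `g` there is a zero of `eulerOp j g`, by Rolle's theorem for
`x ^ (-j) * g`. -/
theorem exists_root_eulerOp (j : ℕ) (g : ℝ[X]) {a b : ℝ} (ha : 0 < a) (hab : a < b)
    (hga : g.eval a = 0) (hgb : g.eval b = 0) :
    ∃ x ∈ Set.Ioo a b, (eulerOp j g).eval x = 0 := by
  have hne : ∀ x ∈ Set.Icc a b, x ^ j ≠ 0 := fun x hx => pow_ne_zero _ (ha.trans_le hx.1).ne'
  obtain ⟨x, hx, hx0⟩ := exists_hasDerivAt_eq_zero (f := fun x => g.eval x / x ^ j)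
    (f' := fun x => ((derivative g).eval x * x ^ j - g.eval x * (j * x ^ (j - 1))) / (x ^ j) ^ 2)
    hab (g.continuous.continuousOn.div (continuous_pow j).continuousOn hne) (by simp [hga, hgb])
    (fun x hx => (g.hasDerivAt x).div (hasDerivAt_pow j x) (hne x (Set.Ioo_subset_Icc_self hx)))
  refine ⟨x, hx, ?_⟩
  have hx1 : 0 < x := ha.trans hx.1
  have h1 : x ^ j ≠ 0 := (pow_pos hx1 j).ne'
  rw [div_eq_zero_iff, or_iff_left (pow_ne_zero 2 h1)] at hx0
  have h2 : (j : ℝ) * x ^ (j - 1) * x = j * x ^ j := by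
    cases j with
    | zero => simp
    | succ n => rw [Nat.add_sub_cancel, pow_succ]; ring
  have h3 : x ^ j * (eulerOp j g).eval x = 0 := by
    simp only [eulerOp, eval_sub, eval_mul, eval_X, eval_C]
    linear_combination x * hx0 + g.eval x * h2
  exact (mul_eq_zero.mp h3).resolve_left h1

theorem exists_roots_eulerOp (j : ℕ) (g : ℝ[X]) {c : ℝ} (hc : 0 ≤ c) (S : Finset ℝ)
    (hS : ∀ x ∈ S, c < x ∧ g.eval x = 0) :
    ∃ S' : Finset ℝ, S.card - 1 ≤ S'.card ∧ ∀ x ∈ S', c < x ∧ (eulerOp j g).eval x = 0 := by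
  rcases hn : S.card with _ | n
  · exact ⟨∅, by simp⟩
  set x := S.orderEmbOfFin hn
  have hx : ∀ i, c < x i ∧ g.eval (x i) = 0 := fun i => hS _ (S.orderEmbOfFin_mem hn i)
  have key : ∀ i : Fin n, ∃ y ∈ Set.Ioo (x i.castSucc) (x i.succ), (eulerOp j g).eval y = 0 :=
    fun i => exists_root_eulerOp j g (hc.trans_lt (hx _).1)
      (x.strictMono i.castSucc_lt_succ) (hx _).2 (hx _).2
  choose y hy hy0 using key
  have hmono : StrictMono y := by
    intro i k hik
    refine (hy i).2.trans_le (le_trans ?_ (hy k).1.le)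
    exact x.monotone (Fin.succ_le_castSucc_iff.mpr hik)
  refine ⟨Finset.univ.image y, ?_, ?_⟩
  · rw [Finset.card_image_of_injective _ hmono.injective]
    simp
  · intro z hz
    obtain ⟨i, -, rfl⟩ := Finset.mem_image.mp hz
    exact ⟨(hx _).1.trans (hy i).1, hy0 i⟩

/-- A nonzero polynomial has fewer positive zeros than monomials. -/
theorem eq_zero_of_card_support_le (g : ℝ[X]) (S : Finset ℝ)
    (hS : ∀ x ∈ S, 0 < x ∧ g.eval x = 0) (hcard : g.support.card ≤ S.card) : g = 0 := by
  induction hn : g.support.card generalizing g S with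
  | zero => simpa using hn
  | succ n ih =>
    obtain ⟨j, hj⟩ : g.support.Nonempty := Finset.card_pos.mp (by omega)
    -- The operator deletes exactly the monomial of degree j, at the cost of at most one zero.
    have hsupp : (eulerOp j g).support = g.support.erase j := by
      ext i
      simp only [mem_support_iff, coeff_eulerOp, Finset.mem_erase, mul_ne_zero_iff, sub_ne_zero,
        ne_eq, Nat.cast_inj]
    have hc : (eulerOp j g).support.card = n := by
      rw [hsupp, Finset.card_erase_of_mem hj]; omega
    obtain ⟨S', hS'c, hS'⟩ := exists_roots_eulerOp j g le_rfl S hS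
    have h0 := ih _ S' hS' (by omega) hc
    have hg : g.support ⊆ {j} := by
      rw [h0, support_zero] at hsupp
      intro i hi
      by_contra hij
      have : i ∈ g.support.erase j := Finset.mem_erase.mpr ⟨by simpa using hij, hi⟩
      rw [← hsupp] at this
      simp at this
    obtain ⟨x, hx⟩ : S.Nonempty := Finset.card_pos.mp (by omega)
    have hx2 := (hS x hx).2
    rw [eval_eq_sum, sum_def, Finset.sum_subset hg (by simp +contextual), Finset.sum_singleton,
      mul_eq_zero, or_iff_left (pow_pos (hS x hx).1 j).ne'] at hx2
    exact absurd hx2 (mem_support_iff.mp hj)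

theorem exists_roots_prod_eulerOp (J : Finset ℕ) (g : ℝ[X]) {c : ℝ} (hc : 0 ≤ c) (S : Finset ℝ)
    (hS : ∀ x ∈ S, c < x ∧ g.eval x = 0) :
    ∃ (h : ℝ[X]) (S' : Finset ℝ), S.card - J.card ≤ S'.card ∧
      (∀ x ∈ S', c < x ∧ h.eval x = 0) ∧
      ∀ i, h.coeff i = (∏ j ∈ J, ((i : ℝ) - j)) * g.coeff i := by
  induction J using Finset.induction_on with
  | empty => exact ⟨g, S, by simp, hS, by simp⟩
  | insert j J hj ih =>
    obtain ⟨h, S', h1, h2, h3⟩ := ih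
    obtain ⟨S'', h4, h5⟩ := exists_roots_eulerOp j h hc S' h2
    refine ⟨eulerOp j h, S'', ?_, h5, fun i => ?_⟩
    · rw [Finset.card_insert_of_notMem hj]; omega
    · rw [coeff_eulerOp, h3, Finset.prod_insert hj, mul_assoc]

/-- A polynomial of degree at most `d` whose `r` lowest coefficients agree, up to a common sign,
with its `r` highest ones has at most `d - r` zeros in `(1, ∞)` unless it vanishes. -/
theorem eq_zero_of_extreme_coeff_symm {d r : ℕ} (hr : 2 * r ≤ d) {ε : ℝ} (hε : ε * ε = 1)
    (g : ℝ[X]) (hd : g.natDegree ≤ d) (hsymm : ∀ i < r, g.coeff i = ε * g.coeff (d - i))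
    (S : Finset ℝ) (hS : ∀ x ∈ S, 1 < x ∧ g.eval x = 0) (hcard : d - r + 1 ≤ S.card) :
    g = 0 := by
  -- The middle block, on which the symmetry hypothesis says nothing. Deleting its d - 2r + 1
  -- monomials leaves at least r zeros in (1, ∞).
  set J := Finset.Icc r (d - r) with hJ
  have hJc : J.card = d - r + 1 - r := by simp [hJ]
  obtain ⟨h, S', h1, h2, h3⟩ := exists_roots_prod_eulerOp J g zero_le_one S hS
  have hJ0 : ∀ i ∈ J, h.coeff i = 0 := by
    intro i hi
    rw [h3, Finset.prod_eq_zero hi (sub_self _), zero_mul]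
  have hgd : ∀ i, d < i → g.coeff i = 0 := fun i hi =>
    coeff_eq_zero_of_natDegree_lt (hd.trans_lt hi)
  have hsub : h.support ⊆ Finset.range (d + 1) \ J := by
    intro i hi
    rw [mem_support_iff] at hi
    rw [Finset.mem_sdiff, Finset.mem_range]
    refine ⟨?_, fun hiJ => hi (hJ0 i hiJ)⟩
    by_contra hid
    exact hi (by rw [h3, hgd i (by omega), mul_zero])
  have hsc : h.support.card ≤ 2 * r := by
    refine (Finset.card_le_card hsub).trans ?_
    rw [Finset.card_sdiff_of_subset, hJc, Finset.card_range]
    · omega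
    · intro i hi
      simp only [hJ, Finset.mem_Icc] at hi
      simp only [Finset.mem_range]; omega
  -- J is invariant under j ↦ d - j, so the factors introduced by the operators respect the symmetry
  -- up to a global sign.
  have hprod : ∀ i ≤ d, ∏ j ∈ J, (((d - i : ℕ) : ℝ) - j) =
      (-1) ^ J.card * ∏ j ∈ J, ((i : ℝ) - j) := by
    intro i hi
    rw [← Finset.prod_const, ← Finset.prod_mul_distrib]
    refine Finset.prod_nbij' (fun j => d - j) (fun j => d - j) ?_ ?_ ?_ ?_ ?_ <;> intro j hj <;>
      simp only [hJ, Finset.mem_Icc] at hj ⊢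
    · omega
    · omega
    · omega
    · omega
    · rw [Nat.cast_sub hi, Nat.cast_sub (by omega)]; ring
  have hg2 : ∀ i ≤ d, i ∉ J → g.coeff (d - i) = ε * g.coeff i := by
    intro i hi hiJ
    simp only [hJ, Finset.mem_Icc, not_and_or, not_le] at hiJ
    rcases hiJ with h | h
    · rw [hsymm i h, ← mul_assoc, hε, one_mul]
    · rw [hsymm (d - i) (by omega), Nat.sub_sub_self hi]
  have hrefl : h.reflect d = C ((-1) ^ J.card * ε) * h := by
    ext i
    rw [coeff_reflect, coeff_C_mul]
    rcases le_or_gt i d with hi | hi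
    · rw [revAt_le hi]
      by_cases hiJ : i ∈ J
      · rw [hJ0 i hiJ, hJ0, mul_zero]
        simp only [hJ, Finset.mem_Icc] at hiJ ⊢; omega
      · rw [h3, h3, hprod i hi, hg2 i hi hiJ]; ring
    · rw [revAt_eq_self_of_lt hi, h3, hgd i hi]; ring
  have hinv : ∀ x ∈ S', h.eval x⁻¹ = 0 := by
    intro x hx
    have hx0 : x ≠ 0 := (zero_lt_one.trans (h2 x hx).1).ne'
    have hc : (-1 : ℝ) ^ J.card * ε ≠ 0 :=
      mul_ne_zero (pow_ne_zero _ (by norm_num)) (left_ne_zero_of_mul (hε ▸ one_ne_zero))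
    have hnd : h.natDegree ≤ d := by
      rw [natDegree_le_iff_coeff_eq_zero]
      intro i hi
      rw [h3, hgd i hi, mul_zero]
    have : Invertible x := invertibleOfNonzero hx0
    have := (eval₂_reflect_eq_zero_iff (RingHom.id ℝ) x d h hnd).mpr (h2 x hx).2
    rw [hrefl, ← eval, invOf_eq_inv, eval_mul, eval_C, mul_eq_zero, or_iff_right hc] at this
    exact this
  -- Zeros above 1 and their inverses give 2r positive zeros, against at most 2r monomials.
  have h0 : h = 0 := by
    refine eq_zero_of_card_support_le h (S' ∪ S'.image (·⁻¹)) ?_ ?_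
    · intro x hx
      rcases Finset.mem_union.mp hx with hx | hx
      · exact ⟨zero_lt_one.trans (h2 x hx).1, (h2 x hx).2⟩
      · obtain ⟨y, hy, rfl⟩ := Finset.mem_image.mp hx
        exact ⟨inv_pos.mpr (zero_lt_one.trans (h2 y hy).1), hinv y hy⟩
    · rw [Finset.card_union_of_disjoint, Finset.card_image_of_injective _ inv_injective]
      · omega
      · rw [Finset.disjoint_left]
        intro x hx hx'
        obtain ⟨y, hy, rfl⟩ := Finset.mem_image.mp hx'
        exact lt_asymm (h2 _ hx).1 (inv_lt_one_of_one_lt₀ (h2 y hy).1)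
  -- Now g is supported on J, with d - 2r + 1 monomials and at least d - r + 1 positive zeros.
  refine eq_zero_of_card_support_le g S (fun x hx => ⟨zero_lt_one.trans (hS x hx).1, (hS x hx).2⟩) ?_
  have : g.support ⊆ J := by
    intro i hi
    by_contra hiJ
    have h4 := h3 i
    rw [h0, coeff_zero, eq_comm, mul_eq_zero, or_iff_left (mem_support_iff.mp hi),
      Finset.prod_eq_zero_iff] at h4
    obtain ⟨j, hj, hij⟩ := h4
    rw [sub_eq_zero, Nat.cast_inj] at hij
    exact hiJ (hij ▸ hj)
  have := Finset.card_le_card this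
  omega

/-! ### Cayley transform and alternating zeros -/

/-- The homogenized substitution `t = (X - 1) / (X + 1)` in a polynomial of degree at most `d`. -/
def cayleyTransform (d : ℕ) (p : ℝ[X]) : ℝ[X] :=
  ∑ j ∈ Finset.range (d + 1), C (p.coeff j) * ((X - 1) ^ j * (X + 1) ^ (d - j))

theorem natDegree_cayleyTransform_le (d : ℕ) (p : ℝ[X]) : (cayleyTransform d p).natDegree ≤ d := by
  refine natDegree_sum_le_of_forall_le _ _ fun j hj => ?_
  rw [Finset.mem_range] at hj
  refine (natDegree_C_mul_le _ _).trans (natDegree_mul_le.trans ?_)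
  have h1 : ((X - 1 : ℝ[X]) ^ j).natDegree ≤ j := by
    simpa using natDegree_pow_le_of_le j (natDegree_X_sub_C_le (1 : ℝ))
  have h2 : ((X + 1 : ℝ[X]) ^ (d - j)).natDegree ≤ d - j := by
    simpa using natDegree_pow_le_of_le (d - j) (natDegree_X_add_C (1 : ℝ)).le
  omega

theorem eval_cayleyTransform {d : ℕ} {p : ℝ[X]} (hp : p.natDegree ≤ d) {y : ℝ} (hy : y + 1 ≠ 0) :
    (cayleyTransform d p).eval y = (y + 1) ^ d * p.eval ((y - 1) / (y + 1)) := by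
  rw [cayleyTransform, eval_finsetSum, eval_eq_sum_range' (Nat.lt_succ_of_le hp), Finset.mul_sum]
  refine Finset.sum_congr rfl fun j hj => ?_
  rw [Finset.mem_range] at hj
  simp only [eval_mul, eval_C, eval_pow, eval_sub, eval_add, eval_X, eval_one]
  rw [← Nat.sub_add_cancel (Nat.le_of_lt_succ hj), pow_add, Nat.add_sub_cancel, div_pow]
  field_simp

/-- Reflection is y ↦ 1/y up to the factor y^d, and this inversion changes the sign of (y - 1)/(y +
1). -/
theorem eval_reflect_cayleyTransform {d : ℕ} {p : ℝ[X]} (hp : p.natDegree ≤ d) {y : ℝ}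
    (hy : 0 < y) : ((cayleyTransform d p).reflect d).eval y =
      (y + 1) ^ d * p.eval (-((y - 1) / (y + 1))) := by
  have : Invertible y⁻¹ := invertibleOfNonzero (inv_pos.mpr hy).ne'
  have h := eval₂_reflect_mul_pow (RingHom.id ℝ) y⁻¹ d (cayleyTransform d p)
    (natDegree_cayleyTransform_le d p)
  rw [← eval, ← eval, invOf_eq_inv, inv_inv,
    eval_cayleyTransform hp (by positivity : y⁻¹ + 1 ≠ 0)] at h
  have h1 : (y⁻¹ - 1) / (y⁻¹ + 1) = -((y - 1) / (y + 1)) := by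
    field_simp; ring
  have h2 : (y⁻¹ + 1) = (y + 1) * y⁻¹ := by field_simp; ring
  rw [h1, h2, mul_pow] at h
  have h3 : y⁻¹ ^ d ≠ 0 := by positivity
  apply mul_right_cancel₀ h3
  rw [h]; ring

theorem eq_zero_of_cayleyTransform_eq_zero {d : ℕ} {p : ℝ[X]} (hp : p.natDegree ≤ d)
    (h : cayleyTransform d p = 0) : p = 0 := by
  refine eq_zero_of_infinite_isRoot p ((Set.Ioo_infinite (zero_lt_one' ℝ)).mono fun t ht => ?_)
  have h1 : (1 - t) ≠ 0 := (sub_pos.mpr ht.2).ne'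
  have h2 : (1 + t) / (1 - t) + 1 = 2 / (1 - t) := by field_simp; ring
  have h3 : ((1 + t) / (1 - t) - 1) / ((1 + t) / (1 - t) + 1) = t := by
    rw [h2]; field_simp; ring
  have h4 := eval_cayleyTransform hp (y := (1 + t) / (1 - t)) (by rw [h2]; positivity)
  rw [h, eval_zero, h3, h2, eq_comm, mul_eq_zero] at h4
  exact h4.resolve_left (by positivity)

/-- If `p` and `q` have degrees at most `d` and `d - 2 r`, and `p ± (1 - t ^ 2) ^ r q` vanishes at
`± t` for `d - r + 1` points `t` of `(0, 1)`, then `p` and `q` vanish. -/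
theorem eq_zero_of_alternating_zeros {d r : ℕ} (hr : 2 * r ≤ d) {p q : ℝ[X]}
    (hp : p.natDegree ≤ d) (hq : q.natDegree ≤ d - 2 * r) (S : Finset ℝ)
    (hS : ∀ t ∈ S, t ∈ Set.Ioo (0 : ℝ) 1) (hcard : d - r + 1 ≤ S.card)
    (h1 : ∀ t ∈ S, p.eval t + (1 - t ^ 2) ^ r * q.eval t = 0)
    (h2 : ∀ t ∈ S, p.eval (-t) - (1 - t ^ 2) ^ r * q.eval (-t) = 0) : p = 0 ∧ q = 0 := by
  set P := cayleyTransform d p with hP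
  set Q₀ := cayleyTransform (d - 2 * r) q with hQ₀
  -- Since 1 - t² = 4y/(y + 1)², this is the degree-d transform of (1 - t²)^r q. Its coefficients
  -- live in degrees r to d - r, so it does not disturb the outer coefficients of P.
  set Q : ℝ[X] := C (4 ^ r) * (Q₀ * X ^ r) with hQ
  set Q' : ℝ[X] := C (4 ^ r) * (Q₀.reflect (d - 2 * r) * X ^ r) with hQ'
  set P' := P.reflect d with hP'
  have hPd : P.natDegree ≤ d := natDegree_cayleyTransform_le d p
  have hQ₀d : Q₀.natDegree ≤ d - 2 * r := natDegree_cayleyTransform_le _ q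
  have hQ₀'d : (Q₀.reflect (d - 2 * r)).natDegree ≤ d - 2 * r :=
    (natDegree_reflect_le).trans (max_le le_rfl hQ₀d)
  have hP'd : P'.natDegree ≤ d := (natDegree_reflect_le).trans (max_le le_rfl hPd)
  have aux : ∀ R : ℝ[X], R.natDegree ≤ d - 2 * r → (C (4 ^ r) * (R * X ^ r)).natDegree ≤ d ∧
      ∀ i < r, (C (4 ^ r) * (R * X ^ r)).coeff i = 0 ∧
        (C (4 ^ r) * (R * X ^ r)).coeff (d - i) = 0 := by
    intro R hR
    have : (C (4 ^ r) * (R * X ^ r)).natDegree ≤ d - 2 * r + r :=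
      (natDegree_C_mul_le _ _).trans (natDegree_mul_le.trans (by
        rw [natDegree_X_pow]; omega))
    refine ⟨by omega, fun i hi => ⟨?_, coeff_eq_zero_of_natDegree_lt (by omega)⟩⟩
    rw [coeff_C_mul, coeff_mul_X_pow', if_neg (by omega), mul_zero]
  obtain ⟨hQd, hQc⟩ := aux Q₀ hQ₀d
  obtain ⟨hQ'd, hQ'c⟩ := aux _ hQ₀'d
  have hPc : ∀ i ≤ d, P'.coeff i = P.coeff (d - i) := fun i hi => by
    rw [hP', coeff_reflect, revAt_le hi]
  have hinj : Set.InjOn (fun t : ℝ => (1 + t) / (1 - t)) S := by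
    intro t ht u hu htu
    have ht1 : 1 - t ≠ 0 := (sub_pos.mpr (hS t ht).2).ne'
    have hu1 : 1 - u ≠ 0 := (sub_pos.mpr (hS u hu).2).ne'
    simp only at htu
    rw [div_eq_div_iff ht1 hu1] at htu
    linarith
  have hScard : d - r + 1 ≤ (S.image fun t => (1 + t) / (1 - t)).card := by
    rwa [Finset.card_image_of_injOn hinj]
  have hroots : ∀ y ∈ S.image fun t => (1 + t) / (1 - t),
      1 < y ∧ P.eval y + Q.eval y = 0 ∧ P'.eval y - Q'.eval y = 0 := by
    intro y hy
    obtain ⟨t, ht, rfl⟩ := Finset.mem_image.mp hy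
    have ht0 := (hS t ht).1
    have ht1 : 0 < 1 - t := sub_pos.mpr (hS t ht).2
    have e1 : (1 + t) / (1 - t) + 1 = 2 / (1 - t) := by field_simp; ring
    have e2 : ((1 + t) / (1 - t) - 1) / ((1 + t) / (1 - t) + 1) = t := by
      rw [e1]; field_simp; ring
    have hpos : 0 < (1 + t) / (1 - t) := by positivity
    have e3 : (2 / (1 - t)) ^ d * (1 - t ^ 2) ^ r =
        4 ^ r * (2 / (1 - t)) ^ (d - 2 * r) * ((1 + t) / (1 - t)) ^ r := by
      have : (2 / (1 - t)) ^ d = (2 / (1 - t)) ^ (d - 2 * r) * ((2 / (1 - t)) ^ 2) ^ r := by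
        rw [← pow_mul, ← pow_add, Nat.sub_add_cancel hr]
      rw [this, mul_assoc, ← mul_pow, mul_comm (4 ^ r), mul_assoc, ← mul_pow]
      congr 2
      field_simp
      ring
    refine ⟨?_, ?_, ?_⟩
    · rw [lt_div_iff₀ ht1]; linarith
    · simp only [hP, hQ, hQ₀, eval_mul, eval_C, eval_pow, eval_X]
      rw [eval_cayleyTransform hp (by positivity), eval_cayleyTransform hq (by positivity), e2, e1]
      linear_combination (2 / (1 - t)) ^ d * h1 t ht - q.eval t * e3
    · simp only [hP', hP, hQ', hQ₀, eval_mul, eval_C, eval_pow, eval_X]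
      rw [eval_reflect_cayleyTransform hp hpos, eval_reflect_cayleyTransform hq hpos, e2, e1]
      linear_combination (2 / (1 - t)) ^ d * h2 t ht + q.eval (-t) * e3
  have G1 : P + P' + Q - Q' = 0 := by
    refine eq_zero_of_extreme_coeff_symm hr (one_mul 1) _ ?_ ?_ _ ?_ hScard
    · exact natDegree_sub_le_of_le (natDegree_add_le_of_degree_le
        (natDegree_add_le_of_degree_le hPd hP'd) hQd) hQ'd |>.trans (by simp)
    · intro i hi
      simp only [coeff_add, coeff_sub, hQc i hi, hQ'c i hi, hPc i (by omega),
        hPc (d - i) (by omega), Nat.sub_sub_self (show i ≤ d by omega), hQ, hQ']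
      ring
    · intro y hy
      obtain ⟨h, h', h''⟩ := hroots y hy
      refine ⟨h, ?_⟩
      simp only [eval_add, eval_sub]
      linarith
  have G2 : P - P' + Q + Q' = 0 := by
    refine eq_zero_of_extreme_coeff_symm hr (by norm_num : (-1 : ℝ) * -1 = 1) _ ?_ ?_ _ ?_ hScard
    · exact natDegree_add_le_of_degree_le (natDegree_add_le_of_degree_le
        ((natDegree_sub_le_of_le hPd hP'd).trans (by simp)) hQd) hQ'd
    · intro i hi
      simp only [coeff_add, coeff_sub, hQc i hi, hQ'c i hi, hPc i (by omega),
        hPc (d - i) (by omega), Nat.sub_sub_self (show i ≤ d by omega), hQ, hQ']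
      ring
    · intro y hy
      obtain ⟨h, h', h''⟩ := hroots y hy
      refine ⟨h, ?_⟩
      simp only [eval_add, eval_sub]
      linarith
  -- G1 and G2 give P = -Q and P' = Q'. Reflecting the latter gives P = Q, so both vanish.
  have hQr : Q'.reflect d = Q := by
    have hX : ((X : ℝ[X]) ^ r).reflect (2 * r) = X ^ r := by
      rw [reflect_monomial, revAt_le (by omega), show 2 * r - r = r by omega]
    have := reflect_mul (Q₀.reflect (d - 2 * r)) (X ^ r) hQ₀'d
      (by rw [natDegree_X_pow]; omega : ((X : ℝ[X]) ^ r).natDegree ≤ 2 * r)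
    rw [Nat.sub_add_cancel hr, hX, reflect_reflect] at this
    rw [hQ', reflect_C_mul, this]
  have hPQ' : P' = Q' := by
    ext i
    have e1 := congrArg (fun f => coeff f i) G1
    have e2 := congrArg (fun f => coeff f i) G2
    simp only [coeff_add, coeff_sub, coeff_zero] at e1 e2
    linarith
  have hPQ : P = Q := by rw [← hQr, ← hPQ', hP', reflect_reflect]
  have hP0 : P = 0 := by
    ext i
    have e1 := congrArg (fun f => coeff f i) G1
    simp only [coeff_add, coeff_sub, coeff_zero, ← hPQ, ← hPQ'] at e1 ⊢
    linarith
  refine ⟨eq_zero_of_cayleyTransform_eq_zero hp hP0, eq_zero_of_cayleyTransform_eq_zero hq ?_⟩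
  rw [hPQ, hQ, mul_eq_zero, mul_eq_zero, or_iff_right (C_ne_zero.mpr (by positivity)),
    or_iff_left (pow_ne_zero r X_ne_zero)] at hP0
  exact hP0

/-! ### Fourier expansion of spherical polynomials -/

/-- The horizontal part `x + i y` of a point `(x, y, z)` of the sphere. -/
def sphereHorizontal (p : UnitSphere) : ℂ :=
  ⟨(p : EuclideanSpace ℝ (Fin 3)) 0, (p : EuclideanSpace ℝ (Fin 3)) 1⟩

theorem conj_mul_sphereHorizontal (p : UnitSphere) :
    (starRingEnd ℂ) (sphereHorizontal p) * sphereHorizontal p = ((1 - sphereHeight p ^ 2 : ℝ) : ℂ) := by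
  have h := p.2
  rw [mem_sphere_zero_iff_norm, EuclideanSpace.norm_eq, Real.sqrt_eq_one] at h
  simp only [Real.norm_eq_abs, sq_abs, Fin.sum_univ_three] at h
  rw [mul_comm, Complex.mul_conj, Complex.normSq_apply]
  congr 1
  simp only [sphereHorizontal, sphereHeight]
  linarith

/-- The function `z ^ j * Re (c * (x + i y) ^ k)` on the sphere. -/
def cylindricalMonomial (j k : ℕ) (c : ℂ) (p : UnitSphere) : ℝ :=
  sphereHeight p ^ j * (c * sphereHorizontal p ^ k).re

/-- The span of the functions `z ^ j * Re (c * (x + i y) ^ k)` with `j + k ≤ n`. -/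
def cylindricalPolynomials (n : ℕ) : Submodule ℝ (UnitSphere → ℝ) :=
  Submodule.span ℝ {f | ∃ j k c, j + k ≤ n ∧ f = cylindricalMonomial j k c}

theorem cylindricalMonomial_mem {n j k : ℕ} (h : j + k ≤ n) (c : ℂ) :
    cylindricalMonomial j k c ∈ cylindricalPolynomials n :=
  Submodule.subset_span ⟨j, k, c, h, rfl⟩

theorem cylindricalPolynomials_mono {n n' : ℕ} (h : n ≤ n') :
    cylindricalPolynomials n ≤ cylindricalPolynomials n' :=
  Submodule.span_mono fun _ ⟨j, k, c, hjk, hf⟩ => ⟨j, k, c, hjk.trans h, hf⟩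

theorem mul_mem_cylindricalPolynomials {n : ℕ} {g : UnitSphere → ℝ}
    (hg : ∀ j k c, j + k ≤ n → g * cylindricalMonomial j k c ∈ cylindricalPolynomials (n + 1))
    {f : UnitSphere → ℝ} (hf : f ∈ cylindricalPolynomials n) :
    g * f ∈ cylindricalPolynomials (n + 1) := by
  induction hf using Submodule.span_induction with
  | mem f hf =>
    obtain ⟨j, k, c, h, rfl⟩ := hf
    exact hg j k c h
  | zero => rw [mul_zero]; exact zero_mem _
  | add f f' _ _ h h' => rw [mul_add]; exact add_mem h h'
  | smul a f _ h => rw [mul_smul_comm]; exact Submodule.smul_mem _ a h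

theorem sphereHeight_mul_mem {n : ℕ} {f : UnitSphere → ℝ} (hf : f ∈ cylindricalPolynomials n) :
    sphereHeight * f ∈ cylindricalPolynomials (n + 1) := by
  refine mul_mem_cylindricalPolynomials (fun j k c h => ?_) hf
  convert cylindricalMonomial_mem (show (j + 1) + k ≤ n + 1 by omega) c using 1
  ext p
  simp only [Pi.mul_apply, cylindricalMonomial]
  ring

/-- Uses Re v Re v' = ½ Re(v v' + v̄ v'). The conjugate term lowers the frequency because w̄ w = 1 -
z² on the sphere, so the total degree grows by only one. -/
theorem re_sphereHorizontal_mul_mem (u : ℂ) {n : ℕ} {f : UnitSphere → ℝ}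
    (hf : f ∈ cylindricalPolynomials n) :
    (fun p => (u * sphereHorizontal p).re) * f ∈ cylindricalPolynomials (n + 1) := by
  refine mul_mem_cylindricalPolynomials (fun j k c h => ?_) hf
  cases k with
  | zero =>
    convert cylindricalMonomial_mem (show j + 1 ≤ n + 1 by omega) (u * c.re) using 1
    ext p
    simp only [Pi.mul_apply, cylindricalMonomial, pow_zero, mul_one, pow_one, Complex.mul_re,
      Complex.mul_im, Complex.ofReal_re, Complex.ofReal_im]
    ring
  | succ k =>
    have key : (fun p => (u * sphereHorizontal p).re) * cylindricalMonomial j (k + 1) c =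
        (1 / 2 : ℝ) • (cylindricalMonomial j (k + 2) (u * c) +
          cylindricalMonomial j k ((starRingEnd ℂ) u * c) -
          cylindricalMonomial (j + 2) k ((starRingEnd ℂ) u * c)) := by
      ext p
      have h1 : ∀ v w : ℂ, v.re * w.re = 1 / 2 * ((v * w).re + ((starRingEnd ℂ) v * w).re) := by
        intro v w
        simp only [Complex.mul_re, Complex.conj_re, Complex.conj_im]
        ring
      have h2 : (starRingEnd ℂ) (u * sphereHorizontal p) * (c * sphereHorizontal p ^ (k + 1)) =
          ((1 - sphereHeight p ^ 2 : ℝ) : ℂ) *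
            ((starRingEnd ℂ) u * c * sphereHorizontal p ^ k) := by
        rw [← conj_mul_sphereHorizontal, map_mul]; ring
      have h3 : u * sphereHorizontal p * (c * sphereHorizontal p ^ (k + 1)) =
          u * c * sphereHorizontal p ^ (k + 2) := by ring
      simp only [Pi.mul_apply, Pi.smul_apply, Pi.add_apply, Pi.sub_apply, cylindricalMonomial,
        smul_eq_mul]
      rw [mul_left_comm, h1, h2, h3, Complex.re_ofReal_mul]
      ring
    rw [key]
    exact Submodule.smul_mem _ _ (sub_mem (add_mem (cylindricalMonomial_mem (by omega) _)
      (cylindricalMonomial_mem (by omega) _)) (cylindricalMonomial_mem (by omega) _))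

theorem pow_mul_mem_cylindricalPolynomials {g : UnitSphere → ℝ}
    (hg : ∀ {n : ℕ} {f}, f ∈ cylindricalPolynomials n → g * f ∈ cylindricalPolynomials (n + 1))
    (k : ℕ) {n : ℕ} {f : UnitSphere → ℝ} (hf : f ∈ cylindricalPolynomials n) :
    g ^ k * f ∈ cylindricalPolynomials (n + k) := by
  induction k with
  | zero => simpa using hf
  | succ k ih => rw [pow_succ', mul_assoc]; exact hg ih

theorem restrictToSphere_monomial (d : Fin 3 →₀ ℕ) :
    restrictToSphere (MvPolynomial.monomial d 1) =
      (fun p => (1 * sphereHorizontal p).re) ^ d 0 *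
        ((fun p => (-Complex.I * sphereHorizontal p).re) ^ d 1 *
          (sphereHeight ^ d 2 * cylindricalMonomial 0 0 1)) := by
  ext p
  simp only [restrictToSphere, LinearMap.pi_apply, AlgHom.toLinearMap_apply,
    MvPolynomial.aeval_monomial, map_one, one_mul, Pi.mul_apply, Pi.pow_apply,
    cylindricalMonomial, pow_zero, Complex.one_re, mul_one]
  rw [Finsupp.prod_fintype _ _ (fun i => pow_zero _), Fin.prod_univ_three, mul_assoc]
  simp [sphereHorizontal, sphereHeight]

theorem restrictToSphere_monomial_mem (d : Fin 3 →₀ ℕ) :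
    restrictToSphere (MvPolynomial.monomial d 1) ∈
      cylindricalPolynomials (0 + d 2 + d 1 + d 0) := by
  rw [restrictToSphere_monomial]
  have h0 : cylindricalMonomial 0 0 1 ∈ cylindricalPolynomials 0 :=
    cylindricalMonomial_mem (Nat.le_refl 0) 1
  have h1 := pow_mul_mem_cylindricalPolynomials sphereHeight_mul_mem (d 2) h0
  have h2 := pow_mul_mem_cylindricalPolynomials
    (re_sphereHorizontal_mul_mem (-Complex.I)) (d 1) h1
  exact pow_mul_mem_cylindricalPolynomials (re_sphereHorizontal_mul_mem 1) (d 0) h2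

theorem sphericalPolynomials_le_cylindricalPolynomials (n : ℕ) :
    sphericalPolynomials n ≤ cylindricalPolynomials n := by
  rw [sphericalPolynomials, MvPolynomial.restrictSupport_eq_span, Submodule.map_span,
    Submodule.span_le]
  rintro _ ⟨P, ⟨d, hd, rfl⟩, rfl⟩
  have hd' : 0 + d 2 + d 1 + d 0 ≤ n := by
    have h : (d.degree : ℤ) ≤ n := hd
    rw [Finsupp.degree_eq_sum, Fin.sum_univ_three] at h
    omega
  exact cylindricalPolynomials_mono hd' (restrictToSphere_monomial_mem d)

/-- Every spherical polynomial of degree at most `n` is a combination of the functions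
`Re ((x + i y) ^ k)` and `Im ((x + i y) ^ k)` whose coefficients are polynomials in `z` of degree at
most `n - k`. -/
theorem exists_fourier_form {n : ℕ} {T : UnitSphere → ℝ} (hT : T ∈ sphericalPolynomials n) :
    ∃ a b : ℕ → ℝ[X], (∀ k j, n < j + k → (a k).coeff j = 0 ∧ (b k).coeff j = 0) ∧ b 0 = 0 ∧
      ∀ p, T p = ∑ k ∈ Finset.range (n + 1),
        ((a k).eval (sphereHeight p) * (sphereHorizontal p ^ k).re +
          (b k).eval (sphereHeight p) * (sphereHorizontal p ^ k).im) := by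
  have h := sphericalPolynomials_le_cylindricalPolynomials n hT
  -- The coefficient b 0 multiplies Im 1 = 0, so it is invisible in T and may be reset to zero.
  suffices ∃ a b : ℕ → ℝ[X], (∀ k j, n < j + k → (a k).coeff j = 0 ∧ (b k).coeff j = 0) ∧
      ∀ p, T p = ∑ k ∈ Finset.range (n + 1),
        ((a k).eval (sphereHeight p) * (sphereHorizontal p ^ k).re +
          (b k).eval (sphereHeight p) * (sphereHorizontal p ^ k).im) by
    obtain ⟨a, b, hab, hs⟩ := this
    refine ⟨a, Function.update b 0 0, fun k j hkj => ⟨(hab k j hkj).1, ?_⟩, by simp, fun p => ?_⟩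
    · rcases eq_or_ne k 0 with rfl | hk
      · simp
      · rw [Function.update_of_ne hk]; exact (hab k j hkj).2
    · rw [hs p]
      refine Finset.sum_congr rfl fun k _ => ?_
      rcases eq_or_ne k 0 with rfl | hk
      · simp
      · rw [Function.update_of_ne hk]
  clear hT
  induction h using Submodule.span_induction with
  | mem f hf =>
    obtain ⟨j, k, c, hjk, rfl⟩ := hf
    refine ⟨Pi.single k (C c.re * X ^ j), Pi.single k (-C c.im * X ^ j), ?_, fun p => ?_⟩
    · intro k' j' hkj
      rcases eq_or_ne k' k with rfl | hk
      · have : j' ≠ j := by omega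
        simp [coeff_X_pow, this]
      · simp [Pi.single_eq_of_ne hk]
    · rw [Finset.sum_eq_single k]
      · simp [cylindricalMonomial, Complex.mul_re]; ring
      · intro k' _ hk
        simp [Pi.single_eq_of_ne hk]
      · intro hk
        rw [Finset.mem_range] at hk
        omega
  | zero => exact ⟨0, 0, by simp, by simp⟩
  | add f f' _ _ h h' =>
    obtain ⟨a, b, hab, hs⟩ := h
    obtain ⟨a', b', hab', hs'⟩ := h'
    refine ⟨a + a', b + b', fun k j hkj => ?_, fun p => ?_⟩
    · simp [hab k j hkj, hab' k j hkj]
    · rw [Pi.add_apply, hs, hs', ← Finset.sum_add_distrib]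
      refine Finset.sum_congr rfl fun k _ => ?_
      simp only [Pi.add_apply, eval_add]; ring
  | smul r f _ h =>
    obtain ⟨a, b, hab, hs⟩ := h
    refine ⟨r • a, r • b, fun k j hkj => ?_, fun p => ?_⟩
    · simp [hab k j hkj]
    · rw [Pi.smul_apply, hs, smul_eq_mul, Finset.mul_sum]
      refine Finset.sum_congr rfl fun k _ => ?_
      simp only [Pi.smul_apply, eval_smul, smul_eq_mul]; ring

/-! ### From Fourier form back to spherical polynomials -/

theorem restrictToSphere_mem {P : MvPolynomial (Fin 3) ℝ} {n : ℤ} (h : (P.totalDegree : ℤ) ≤ n) :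
    restrictToSphere P ∈ sphericalPolynomials n := by
  refine Submodule.mem_map_of_mem ((MvPolynomial.mem_restrictSupport_iff ℝ).mpr fun d hd => ?_)
  exact le_trans (Int.ofNat_le.mpr (MvPolynomial.le_totalDegree hd)) h

theorem exists_mvPolynomial_horizontal_pow (k : ℕ) : ∃ P Q : MvPolynomial (Fin 3) ℝ,
    P.totalDegree ≤ k ∧ Q.totalDegree ≤ k ∧
    ∀ p, restrictToSphere P p = (sphereHorizontal p ^ k).re ∧
      restrictToSphere Q p = (sphereHorizontal p ^ k).im := by
  induction k with
  | zero => exact ⟨1, 0, by simp, by simp, fun p => by simp [restrictToSphere]⟩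
  | succ k ih =>
    obtain ⟨P, Q, hP, hQ, h⟩ := ih
    have hX : ∀ (i : Fin 3) (R : MvPolynomial (Fin 3) ℝ), R.totalDegree ≤ k →
        (MvPolynomial.X i * R).totalDegree ≤ k + 1 := by
      intro i R hR
      refine (MvPolynomial.totalDegree_mul _ _).trans ?_
      rw [MvPolynomial.totalDegree_X]; omega
    refine ⟨MvPolynomial.X 0 * P - MvPolynomial.X 1 * Q, MvPolynomial.X 0 * Q + MvPolynomial.X 1 * P,
      (MvPolynomial.totalDegree_sub _ _).trans (max_le (hX _ _ hP) (hX _ _ hQ)),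
      (MvPolynomial.totalDegree_add _ _).trans (max_le (hX _ _ hQ) (hX _ _ hP)), fun p => ?_⟩
    obtain ⟨h1, h2⟩ := h p
    simp only [restrictToSphere, LinearMap.pi_apply, AlgHom.toLinearMap_apply] at h1 h2 ⊢
    rw [pow_succ', Complex.mul_re, Complex.mul_im, map_sub, map_add, map_mul, map_mul, map_mul,
      map_mul, MvPolynomial.aeval_X, MvPolynomial.aeval_X, h1, h2]
    exact ⟨rfl, rfl⟩

theorem exists_mvPolynomial_height (A : ℝ[X]) : ∃ R : MvPolynomial (Fin 3) ℝ,
    R.totalDegree ≤ A.natDegree ∧ ∀ p, restrictToSphere R p = A.eval (sphereHeight p) := by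
  refine ⟨aeval (MvPolynomial.X 2) A, ?_, fun p => ?_⟩
  · rw [aeval_eq_sum_range]
    refine MvPolynomial.totalDegree_finsetSum_le fun i hi => ?_
    refine (MvPolynomial.totalDegree_smul_le _ _).trans ?_
    rw [MvPolynomial.totalDegree_X_pow]
    exact Nat.le_of_lt_succ (Finset.mem_range.mp hi)
  · simp only [restrictToSphere, LinearMap.pi_apply, AlgHom.toLinearMap_apply]
    rw [← aeval_algHom_apply, MvPolynomial.aeval_X]
    rfl

/-- The zero alternative is separate because `natDegree` of 0 is 0, while n - k may be negative. -/
theorem height_mul_horizontal_mem {A B : ℝ[X]} {k : ℕ} {n : ℤ}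
    (hA : A = 0 ∨ (A.natDegree : ℤ) + k ≤ n) (hB : B = 0 ∨ (B.natDegree : ℤ) + k ≤ n) :
    (fun p => A.eval (sphereHeight p) * (sphereHorizontal p ^ k).re +
      B.eval (sphereHeight p) * (sphereHorizontal p ^ k).im) ∈ sphericalPolynomials n := by
  obtain ⟨P, Q, hP, hQ, hPQ⟩ := exists_mvPolynomial_horizontal_pow k
  have aux : ∀ (A : ℝ[X]) (P : MvPolynomial (Fin 3) ℝ), A = 0 ∨ (A.natDegree : ℤ) + k ≤ n →
      P.totalDegree ≤ k → (fun p => A.eval (sphereHeight p) * restrictToSphere P p) ∈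
        sphericalPolynomials n := by
    intro A P hA hP
    rcases hA with rfl | hA
    · simp only [eval_zero, zero_mul]; exact zero_mem _
    · obtain ⟨R, hR, hRA⟩ := exists_mvPolynomial_height A
      convert restrictToSphere_mem (P := R * P) (n := n) ?_ using 1
      · ext p
        rw [← hRA]
        simp [restrictToSphere]
      · have := MvPolynomial.totalDegree_mul R P
        omega
  convert add_mem (aux A P hA hP) (aux B Q hB hQ) using 1
  ext p
  rw [Pi.add_apply, (hPQ p).1, (hPQ p).2]

theorem eq_zero_of_mem_sphericalPolynomials_neg {n : ℤ} (hn : n < 0) {T : UnitSphere → ℝ}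
    (hT : T ∈ sphericalPolynomials n) : T = 0 := by
  obtain ⟨P, hP, rfl⟩ := hT
  have : P = 0 := by
    rw [← MvPolynomial.support_eq_empty, Finset.eq_empty_iff_forall_notMem]
    intro d hd
    have h : (d.degree : ℤ) ≤ n := hP hd
    omega
  rw [this, map_zero]

/-! ### Aliasing on a latitude circle -/

/-- If `∑ Re (c k * ζ ^ k)`, of degree at most `M`, vanishes at the `M + 1` roots of modulus one of
`ζ ^ (M + 1) = σ`, then its aliased coefficients cancel. -/
theorem aliased_coeff_eq_zero {M : ℕ} {σ : ℂ} (c : ℕ → ℂ) (N : Finset ℂ) (hN : M + 1 ≤ N.card)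
    (h : ∀ ζ ∈ N, ζ * (starRingEnd ℂ) ζ = 1 ∧ ζ ^ (M + 1) = σ ∧
      (∑ k ∈ Finset.range (M + 1), c k * ζ ^ k).re = 0) :
    (c 0).re = 0 ∧ ∀ k < M, c (k + 1) + (starRingEnd ℂ) σ * (starRingEnd ℂ) (c (M - k)) = 0 := by
  -- At the nodes conj ζ = ζ⁻¹ and ζ^(M+1) = σ, so the sum plus its conjugate agrees with F, which
  -- has degree at most M but M + 1 zeros.
  set F : ℂ[X] := ∑ k ∈ Finset.range M,
      C (c (k + 1) + (starRingEnd ℂ) σ * (starRingEnd ℂ) (c (M - k))) * X ^ (k + 1) +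
    C (c 0 + (starRingEnd ℂ) (c 0)) with hF
  have hdeg : F.natDegree < N.card := by
    refine lt_of_le_of_lt ?_ hN
    refine natDegree_add_le_of_degree_le (natDegree_sum_le_of_forall_le _ _ fun k hk => ?_)
      ((natDegree_C _).trans_le (Nat.zero_le _))
    exact (natDegree_C_mul_X_pow_le _ _).trans (Finset.mem_range.mp hk)
  have hF0 : F = 0 := by
    refine eq_zero_of_natDegree_lt_card_of_eval_eq_zero' F N (fun ζ hζ => ?_) hdeg
    obtain ⟨h1, h2, h3⟩ := h ζ hζ
    have hconj : ∀ k < M, (starRingEnd ℂ) ζ ^ (M - k) = (starRingEnd ℂ) σ * ζ ^ (k + 1) := by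
      intro k hk
      calc (starRingEnd ℂ) ζ ^ (M - k)
          = (starRingEnd ℂ) ζ ^ (M - k) * (ζ * (starRingEnd ℂ) ζ) ^ (k + 1) := by
            rw [h1, one_pow, mul_one]
        _ = (starRingEnd ℂ) ζ ^ (M - k + (k + 1)) * ζ ^ (k + 1) := by
            rw [pow_add, mul_pow]; ring
        _ = (starRingEnd ℂ) σ * ζ ^ (k + 1) := by
            rw [show M - k + (k + 1) = M + 1 by omega, ← map_pow, h2]
    have hsum : (∑ k ∈ Finset.range (M + 1), c k * ζ ^ k) +
        (starRingEnd ℂ) (∑ k ∈ Finset.range (M + 1), c k * ζ ^ k) = 0 := by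
      rw [Complex.add_conj, h3]; simp
    rw [← hsum, map_sum, Finset.sum_range_succ', Finset.sum_range_succ',
      ← Finset.sum_range_reflect (fun k => (starRingEnd ℂ) (c (k + 1) * ζ ^ (k + 1))), hF, eval_add,
      eval_finsetSum, eval_C]
    have : ∀ k ∈ Finset.range M, (C (c (k + 1) + (starRingEnd ℂ) σ * (starRingEnd ℂ) (c (M - k))) *
        X ^ (k + 1)).eval ζ = c (k + 1) * ζ ^ (k + 1) +
        (starRingEnd ℂ) (c (M - 1 - k + 1) * ζ ^ (M - 1 - k + 1)) := by
      intro k hk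
      have hk' := Finset.mem_range.mp hk
      rw [show M - 1 - k + 1 = M - k by omega, map_mul, map_pow, hconj k hk']
      simp only [eval_mul, eval_C, eval_pow, eval_X]
      ring
    rw [Finset.sum_congr rfl this, Finset.sum_add_distrib]
    simp only [pow_zero, mul_one]
    ring
  constructor
  · have := congrArg (fun f => coeff f 0) hF0
    simp only [hF, coeff_add, finsetSum_coeff, coeff_C_mul, coeff_X_pow, coeff_C_zero,
      coeff_zero] at this
    simpa [Complex.add_conj] using this
  · intro k hk
    have := congrArg (fun f => coeff f (k + 1)) hF0
    simp only [hF, coeff_add, finsetSum_coeff, coeff_C_mul, coeff_X_pow, coeff_C_succ,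
      coeff_zero] at this
    rw [Finset.sum_eq_single k] at this
    · simpa using this
    · intro b _ hb
      simp [hb.symm]
    · intro hk'
      exact absurd (Finset.mem_range.mpr hk) hk'

theorem sphereHeight_spherePoint (θ φ : ℝ) : sphereHeight (spherePoint θ φ) = Real.cos θ := rfl

theorem sphereHorizontal_spherePoint (θ φ : ℝ) :
    sphereHorizontal (spherePoint θ φ) = Real.sin θ * Complex.exp (φ * Complex.I) := by
  apply Complex.ext
  · rw [Complex.re_ofReal_mul, Complex.exp_ofReal_mul_I_re]; rfl
  · rw [Complex.im_ofReal_mul, Complex.exp_ofReal_mul_I_im]; rfl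

theorem exists_equidistant_nodes (α : ℝ) {m : ℕ} (hm : 0 < m) : ∃ N : Finset ℂ, N.card = 2 * m ∧
    ∀ ζ ∈ N, ζ ^ (2 * m) = Complex.exp (α * Real.pi * Complex.I) ∧
      ∃ φ ∈ equidistantAngles α m, ζ = Complex.exp (φ * Complex.I) := by
  have hm0 : 2 * m ≠ 0 := by omega
  have hmC : (m : ℂ) ≠ 0 := by exact_mod_cast hm.ne'
  set η := Complex.exp (2 * Real.pi * Complex.I / (2 * m : ℕ)) with hη
  have hprim : IsPrimitiveRoot η (2 * m) := Complex.isPrimitiveRoot_exp _ hm0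
  set ζ₀ := Complex.exp (α * Real.pi / (2 * m) * Complex.I) with hζ₀
  have hζ₀0 : ζ₀ ≠ 0 := Complex.exp_ne_zero _
  refine ⟨(Finset.range (2 * m)).image fun j => η ^ j * ζ₀, ?_, ?_⟩
  · rw [Finset.card_image_of_injOn, Finset.card_range]
    intro i hi j hj hij
    exact hprim.pow_inj (Finset.mem_range.mp hi) (Finset.mem_range.mp hj)
      (mul_right_cancel₀ hζ₀0 hij)
  · intro ζ hζ
    obtain ⟨j, hj, rfl⟩ := Finset.mem_image.mp hζ
    refine ⟨?_, _, ⟨j, Finset.mem_range.mp hj, rfl⟩, ?_⟩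
    · rw [mul_pow, ← pow_mul, mul_comm j, pow_mul, hprim.pow_eq_one, one_pow, one_mul, hζ₀,
        ← Complex.exp_nat_mul]
      congr 1
      push_cast
      field_simp
    · rw [hη, hζ₀, ← Complex.exp_nat_mul, ← Complex.exp_add]
      congr 1
      push_cast
      field_simp

/-- Aliasing with M + 1 = 2m, applied to c_k = (a_k - i b_k) sin^k θ. Conjugation reverses the sign
for b. Division by sin^k θ > 0 leaves sin^(2m-2k) θ = (1 - t²)^(m-k). -/
theorem aliased_fourier_coeff {m s : ℕ} (hm : 0 < m) (hs : s ≤ 2 * m - 1) {a b : ℕ → ℝ[X]}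
    (ha : ∀ k, s < k → a k = 0) (hb : ∀ k, s < k → b k = 0) {T : UnitSphere → ℝ}
    (hT : ∀ p, T p = ∑ k ∈ Finset.range (s + 1),
      ((a k).eval (sphereHeight p) * (sphereHorizontal p ^ k).re +
        (b k).eval (sphereHeight p) * (sphereHorizontal p ^ k).im))
    {θ α σ : ℝ} (hθ : θ ∈ Set.Ioo 0 Real.pi) (hσ : Complex.exp (α * Real.pi * Complex.I) = σ)
    (hzero : ∀ φ ∈ equidistantAngles α m, T (spherePoint θ φ) = 0) :
    (a 0).eval (Real.cos θ) = 0 ∧ ∀ k, 0 < k → k ≤ m →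
      (a k).eval (Real.cos θ) +
        σ * ((1 - Real.cos θ ^ 2) ^ (m - k) * (a (2 * m - k)).eval (Real.cos θ)) = 0 ∧
      (b k).eval (Real.cos θ) -
        σ * ((1 - Real.cos θ ^ 2) ^ (m - k) * (b (2 * m - k)).eval (Real.cos θ)) = 0 := by
  set t := Real.cos θ with ht
  have hsin : 0 < Real.sin θ := Real.sin_pos_of_mem_Ioo hθ
  set c : ℕ → ℂ := fun k =>
    ⟨(a k).eval t * Real.sin θ ^ k, -((b k).eval t * Real.sin θ ^ k)⟩ with hc
  obtain ⟨N, hN, hNz⟩ := exists_equidistant_nodes α hm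
  obtain ⟨h0, h⟩ := aliased_coeff_eq_zero (M := 2 * m - 1) (σ := σ) c N (by omega) (by
    intro ζ hζ
    obtain ⟨hζ1, φ, hφ, rfl⟩ := hNz ζ hζ
    refine ⟨?_, ?_, ?_⟩
    · rw [Complex.mul_conj, Complex.normSq_eq_norm_sq, Complex.norm_exp_ofReal_mul_I]; simp
    · rw [Nat.sub_add_cancel (by omega), hζ1, hσ]
    · rw [← hzero φ hφ, hT, Complex.re_sum]
      symm
      refine Finset.sum_subset_zero_on_sdiff (Finset.range_mono (by omega)) ?_ ?_
      · intro k hk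
        simp only [Finset.mem_sdiff, Finset.mem_range] at hk
        have : c k = 0 := by
          simp only [hc, ha k (by omega), hb k (by omega), eval_zero, zero_mul, neg_zero]
          rfl
        rw [this, zero_mul, Complex.zero_re]
      · intro k _
        rw [sphereHeight_spherePoint, sphereHorizontal_spherePoint, mul_pow, ← Complex.ofReal_pow,
          Complex.re_ofReal_mul, Complex.im_ofReal_mul, Complex.mul_re]
        simp only [hc]
        ring)
  refine ⟨by simpa [hc] using h0, fun k hk hkm => ?_⟩
  have h1 := h (k - 1) (by omega)
  rw [Nat.sub_add_cancel hk, show 2 * m - 1 - (k - 1) = 2 * m - k by omega, Complex.conj_ofReal]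
    at h1
  have hpow : Real.sin θ ^ (2 * m - k) = (1 - t ^ 2) ^ (m - k) * Real.sin θ ^ k := by
    rw [ht, ← Real.sin_sq, ← pow_mul, ← pow_add]
    congr 1
    omega
  have hk0 : Real.sin θ ^ k ≠ 0 := (pow_pos hsin k).ne'
  have hre := congrArg Complex.re h1
  have him := congrArg Complex.im h1
  rw [Complex.add_re, Complex.re_ofReal_mul, Complex.conj_re, Complex.zero_re] at hre
  rw [Complex.add_im, Complex.im_ofReal_mul, Complex.conj_im, Complex.zero_im] at him
  simp only [hc, hpow] at hre him
  constructor <;> refine (mul_eq_zero.mp ?_).resolve_left hk0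
  · linear_combination hre
  · linear_combination -him

/-! ### Symmetric latitudes and the factorization -/

theorem eq_zero_of_symmetric_zeros {lam d r : ℕ} (hr : 2 * r ≤ d) (hlam : lam = d - r + 1)
    {t : Fin (2 * lam) → ℝ} (ht : Function.Injective t) (ht1 : ∀ i, t i ∈ Set.Ioo (-1 : ℝ) 1)
    (hsymm : ∀ i, t i.rev = -t i)
    (hside : (∀ i : Fin (2 * lam), i.val < lam → 0 < t i) ∨
      (∀ i : Fin (2 * lam), i.val < lam → t i < 0))
    {p q : ℝ[X]} (hp : p.natDegree ≤ d) (hq : q.natDegree ≤ d - 2 * r)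
    (h : ∀ i : Fin (2 * lam), p.eval (t i) +
      (if i.val < lam then 1 else -1) * ((1 - t i ^ 2) ^ r * q.eval (t i)) = 0) :
    p = 0 ∧ q = 0 := by
  obtain ⟨δ, hδ, hpos⟩ : ∃ δ : ℝ, (δ = 1 ∨ δ = -1) ∧
      ∀ i : Fin (2 * lam), i.val < lam → 0 < δ * t i := by
    rcases hside with hs | hs
    · exact ⟨1, Or.inl rfl, fun i hi => by simpa using hs i hi⟩
    · exact ⟨-1, Or.inr rfl, fun i hi => by simpa using hs i hi⟩
  have hδ0 : δ ≠ 0 := by rcases hδ with rfl | rfl <;> norm_num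
  let e : Fin lam → Fin (2 * lam) := fun i => ⟨i, by omega⟩
  have he : Function.Injective e := fun i j hij => Fin.ext (by simpa [e] using hij)
  have hinj : Function.Injective fun i => δ * t (e i) := fun i j hij =>
    he (ht (mul_left_cancel₀ hδ0 hij))
  have hrel : ∀ i, p.eval (t (e i)) + (1 - t (e i) ^ 2) ^ r * q.eval (t (e i)) = 0 ∧
      p.eval (-t (e i)) - (1 - t (e i) ^ 2) ^ r * q.eval (-t (e i)) = 0 := by
    intro i
    have h1 := h (e i)
    have h2 := h (e i).rev
    rw [if_pos (show (e i).val < lam from i.2)] at h1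
    rw [if_neg (by rw [Fin.val_rev]; simp only [e]; omega), hsymm, neg_sq] at h2
    exact ⟨by linarith, by linarith⟩
  -- For nodes with t < 0, passing to -t exchanges the two relations, which amounts to replacing q
  -- by -q.
  have key := eq_zero_of_alternating_zeros hr hp (q := C δ * q)
    ((natDegree_C_mul_le _ _).trans hq) (Finset.univ.image fun i => δ * t (e i)) ?_ ?_ ?_ ?_
  · rw [mul_eq_zero, or_iff_right (C_ne_zero.mpr hδ0)] at key
    exact key
  · intro x hx
    obtain ⟨i, -, rfl⟩ := Finset.mem_image.mp hx
    refine ⟨hpos (e i) i.2, ?_⟩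
    have := ht1 (e i)
    rcases hδ with rfl | rfl
    · linarith [this.2]
    · linarith [this.1]
  · rw [Finset.card_image_of_injective _ hinj, Finset.card_univ, Fintype.card_fin, hlam]
  all_goals
    intro x hx
    obtain ⟨i, -, rfl⟩ := Finset.mem_image.mp hx
    obtain ⟨h1, h2⟩ := hrel i
    rcases hδ with rfl | rfl
    all_goals
      simp only [eval_mul, eval_C, one_mul, neg_one_mul, neg_sq, neg_neg]
      linarith

theorem prod_X_sub_C_dvd {ι : Type*} [Fintype ι] {t : ι → ℝ} (ht : Function.Injective t) {p : ℝ[X]}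
    (h : ∀ i, p.eval (t i) = 0) : ∏ i, (X - C (t i)) ∣ p :=
  Finset.prod_dvd_of_coprime ((pairwise_coprime_X_sub_C ht).set_pairwise _)
    fun i _ => dvd_iff_isRoot.mpr (h i)

theorem mainTheorem2 (m s lam : ℕ) (hm : 0 < m) (hms : m ≤ s) (hsm : s ≤ 2 * m - 1)
    (hlam : lam = s - m + 1)
    -- the angle with index `i : Fin (2 * lam)` is the angle number `i + 1`
    (θ : Fin (2 * lam) → ℝ) (hθ : Function.Injective θ)
    (hθ_mem : ∀ i, θ i ∈ Set.Ioo 0 Real.pi)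
    (hθ_symm : ∀ i, θ (Fin.rev i) = Real.pi - θ i)
    (hθ_side : (∀ i : Fin (2 * lam), i.val < lam → θ i < Real.pi / 2) ∨
      (∀ i : Fin (2 * lam), i.val < lam → Real.pi / 2 < θ i))
    (T : UnitSphere → ℝ) (hT : T ∈ sphericalPolynomials (s : ℤ))
    (hT_zero : ∀ i : Fin (2 * lam),
      ∀ φ ∈ equidistantAngles (if i.val < lam then 0 else 1) m, T (spherePoint (θ i) φ) = 0) :
    ∃ Tstar ∈ sphericalPolynomials ((s : ℤ) - 2 * (lam : ℤ)),
      (∀ p : UnitSphere,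
        T p = (∏ i : Fin (2 * lam), (sphereHeight p - Real.cos (θ i))) * Tstar p) ∧
      (s = 2 * m - 1 → Tstar = 0) := by
  obtain ⟨a, b, hab, hb0, hform⟩ := exists_fourier_form hT
  have hazero : ∀ k, s < k → a k = 0 := fun k hk => by
    ext j; exact (hab k j (by omega)).1
  have hbzero : ∀ k, s < k → b k = 0 := fun k hk => by
    ext j; exact (hab k j (by omega)).2
  have hdeg : ∀ k ≤ s, (a k).natDegree ≤ s - k ∧ (b k).natDegree ≤ s - k := fun k hk =>
    ⟨natDegree_le_iff_coeff_eq_zero.mpr fun j hj => (hab k j (by omega)).1,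
      natDegree_le_iff_coeff_eq_zero.mpr fun j hj => (hab k j (by omega)).2⟩
  set t : Fin (2 * lam) → ℝ := fun i => Real.cos (θ i) with ht
  have hcos : ∀ x ∈ Set.Ioo 0 Real.pi, x ∈ Set.Icc 0 Real.pi := fun x hx =>
    Set.Ioo_subset_Icc_self hx
  have htinj : Function.Injective t := fun i j hij =>
    hθ (Real.injOn_cos (hcos _ (hθ_mem i)) (hcos _ (hθ_mem j)) hij)
  have htmem : ∀ i, t i ∈ Set.Ioo (-1 : ℝ) 1 := by
    intro i
    obtain ⟨h0, h1⟩ := hθ_mem i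
    constructor
    · rw [← Real.cos_pi]
      exact Real.cos_lt_cos_of_nonneg_of_le_pi h0.le le_rfl h1
    · rw [← Real.cos_zero]
      exact Real.cos_lt_cos_of_nonneg_of_le_pi le_rfl h1.le h0
  have htsymm : ∀ i, t i.rev = -t i := fun i => by
    simp only [ht, hθ_symm, Real.cos_pi_sub]
  have htside : (∀ i : Fin (2 * lam), i.val < lam → 0 < t i) ∨
      (∀ i : Fin (2 * lam), i.val < lam → t i < 0) := by
    refine hθ_side.imp (fun h i hi => ?_) fun h i hi => ?_
    · exact Real.cos_pos_of_mem_Ioo ⟨by linarith [(hθ_mem i).1, Real.pi_pos], h i hi⟩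
    · exact Real.cos_neg_of_pi_div_two_lt_of_lt (h i hi) (by linarith [(hθ_mem i).2, Real.pi_pos])
  have hrel := fun i => aliased_fourier_coeff (σ := if i.val < lam then 1 else -1) hm hsm hazero
    hbzero hform (hθ_mem i) (by split_ifs <;> simp [Complex.exp_pi_mul_I]) (hT_zero i)
  -- the coefficients of intermediate frequency vanish
  have hmid : ∀ k, 0 < k → k < m → 2 * m - s ≤ k →
      a k = 0 ∧ a (2 * m - k) = 0 ∧ b k = 0 ∧ b (2 * m - k) = 0 := by
    intro k hk0 hkm hk
    have h1 := hdeg k (by omega)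
    have h2 := hdeg (2 * m - k) (by omega)
    -- Here d - r + 1 = s - m + 1 = λ, and d - 2r = s - (2m - k) bounds the degree of the partner
    -- coefficient.
    have hA := eq_zero_of_symmetric_zeros (d := s - k) (r := m - k) (by omega) (by omega) htinj
      htmem htsymm htside h1.1 (h2.1.trans (by omega)) fun i => ((hrel i).2 k hk0 hkm.le).1
    have hB := eq_zero_of_symmetric_zeros (d := s - k) (r := m - k) (q := -b (2 * m - k))
      (by omega) (by omega) htinj
      htmem htsymm htside h1.2 (by rw [natDegree_neg]; exact h2.2.trans (by omega)) fun i => by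
        rw [eval_neg]
        linear_combination ((hrel i).2 k hk0 hkm.le).2
    exact ⟨hA.1, hA.2, hB.1, neg_eq_zero.mp hB.2⟩
  -- Frequency m is its own alias: the relations read 2 a_m = 0 where σ = 1 and 2 b_m = 0 where σ =
  -- -1, so each has λ zeros.
  have hmm : a m = 0 ∧ b m = 0 := by
    have h1 := hdeg m hms
    let e : Fin lam → Fin (2 * lam) := fun i => ⟨i, by omega⟩
    have he : Function.Injective e := fun i j hij => Fin.ext (by simpa [e] using hij)
    have hr : ∀ i, (a m).eval (t i) + (if i.val < lam then 1 else -1) * (a m).eval (t i) = 0 ∧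
        (b m).eval (t i) - (if i.val < lam then 1 else -1) * (b m).eval (t i) = 0 := by
      intro i
      have := (hrel i).2 m hm le_rfl
      rwa [Nat.sub_self, pow_zero, one_mul, one_mul, show 2 * m - m = m by omega] at this
    constructor
    · refine eq_zero_of_natDegree_lt_card_of_eval_eq_zero (a m) (htinj.comp he) (fun i => ?_) ?_
      · have := (hr (e i)).1
        rw [if_pos (show (e i).val < lam from i.2)] at this
        simp only [Function.comp]; linarith
      · rw [Fintype.card_fin]; omega
    · refine eq_zero_of_natDegree_lt_card_of_eval_eq_zero (b m)
        (htinj.comp (Fin.rev_injective.comp he)) (fun i => ?_) ?_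
      · have := (hr (e i).rev).2
        rw [if_neg (by rw [Fin.val_rev]; simp only [e]; omega)] at this
        simp only [Function.comp]; linarith
      · rw [Fintype.card_fin]; omega
  have hall : ∀ k i, (a k).eval (t i) = 0 ∧ (b k).eval (t i) = 0 := by
    intro k i
    rcases Nat.eq_zero_or_pos k with rfl | hk0
    · exact ⟨(hrel i).1, by rw [hb0, eval_zero]⟩
    rcases lt_or_ge s k with hsk | hks
    · rw [hazero k hsk, hbzero k hsk]; simp
    rcases lt_trichotomy k m with hkm | rfl | hkm
    · rcases lt_or_ge k (2 * m - s) with hk | hk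
      · have := (hrel i).2 k hk0 hkm.le
        simpa [hazero (2 * m - k) (by omega), hbzero (2 * m - k) (by omega)] using this
      · obtain ⟨h1, -, h2, -⟩ := hmid k hk0 hkm hk
        rw [h1, h2]; simp
    · rw [hmm.1, hmm.2]; simp
    · obtain ⟨-, h1, -, h2⟩ := hmid (2 * m - k) (by omega) (by omega) (by omega)
      rw [show 2 * m - (2 * m - k) = k by omega] at h1 h2
      rw [h1, h2]; simp
  choose a' ha' using fun k => prod_X_sub_C_dvd htinj fun i => (hall k i).1
  choose b' hb' using fun k => prod_X_sub_C_dvd htinj fun i => (hall k i).2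
  have hW : (∏ i, (X - C (t i))).natDegree = 2 * lam := by
    rw [natDegree_finsetProd_X_sub_C_eq_card, Finset.card_univ, Fintype.card_fin]
  have hW0 : ∏ i, (X - C (t i)) ≠ 0 := Finset.prod_ne_zero_iff.mpr fun i _ => X_sub_C_ne_zero _
  have hquot : ∀ {k} {f f' : ℝ[X]}, k ≤ s → f.natDegree ≤ s - k →
      f = (∏ i, (X - C (t i))) * f' → f' = 0 ∨ (f'.natDegree : ℤ) + k ≤ (s : ℤ) - 2 * lam := by
    intro k f f' hk hf hff'
    refine or_iff_not_imp_left.mpr fun hf' => ?_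
    rw [hff', natDegree_mul hW0 hf', hW] at hf
    omega
  have hmem : (∑ k ∈ Finset.range (s + 1), fun p : UnitSphere =>
      (a' k).eval (sphereHeight p) * (sphereHorizontal p ^ k).re +
        (b' k).eval (sphereHeight p) * (sphereHorizontal p ^ k).im) ∈
      sphericalPolynomials ((s : ℤ) - 2 * lam) := by
    refine sum_mem fun k hk => ?_
    have hks := Nat.le_of_lt_succ (Finset.mem_range.mp hk)
    exact height_mul_horizontal_mem (hquot hks (hdeg k hks).1 (ha' k))
      (hquot hks (hdeg k hks).2 (hb' k))
  -- For s = 2m - 1 one has λ = m, so s - 2λ = -1.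
  refine ⟨_, hmem, fun p => ?_, fun hs => eq_zero_of_mem_sphericalPolynomials_neg (by omega) hmem⟩
  rw [hform, Finset.sum_apply, Finset.mul_sum]
  refine Finset.sum_congr rfl fun k _ => ?_
  conv_lhs => rw [ha' k, hb' k]
  simp only [eval_mul, eval_prod, eval_sub, eval_X, eval_C]
  ring

end
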